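/- Let $G=(V,E)$ be a finite graph, and let $\mathcal S$ be the family of the edge sets of all paths in $G$ (paths with no repeated vertex, between arbitrary endpoints). For an attribute function $w:E\to\mathbb R_{\ge 0}$ the counting query on $S\in\mathcal S$ is $w(S)=\sum_{e\in S}w(e)$. The graph is public. A mechanism assigns to every $w$ a random vector $\mathcal A(w)\in\mathbb R^{\mathcal S}$ of answers. It is $(\varepsilon,\delta)$-differentially private if $$\Pr[\mathcal A(w)\in C]\le e^{\varepsilon}\Pr[\mathcal A(w')\in C]+\delta$$ for all $w,w'$ with $\sum_{e\in E}|w(e)-w'(e)|\le 1$ and all measurable $C\subseteq\mathbb R^{\mathcal S}$. It has additive error at most $\alpha$ with failure probability $\beta$ if, for every $w$, $$\Pr\big[\,|w(S)-\mathcal A(w)_S|\le\alpha\ \text{ for all } S\in\mathcal S\,\big]\ge 1-\beta .$$ **Theorem.** Every $(\varepsilon,\delta)$-differentially private mechanism for counting queries on all paths of a graph incurs additive error $\Omega(n)$ in the worst case, where $n$ is the number of vertices. Precisely: for all $\varepsilon,\delta,\beta\ge 0$ with $\delta+\beta<1$ there is a constant $c>0$, depending only on $\varepsilon,\delta,\beta$,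 such that for every $n\ge 2$ there is a simple graph $G$ on $n$ vertices with the following property: if an $(\varepsilon,\delta)$-differentially private mechanism for the counting queries on all paths of $G$ has additive error at most $\alpha$ with failure probability $\beta$, then $\alpha\ge c\,n$. -/

import Mathlib

open MeasureTheory
open scoped NNReal

namespace RangeQuery

/-- A range query system on the finite ground set `X` is a collection `𝒮` of subsets of `X` (the
ranges).  For an attribute function `w : X → ℝ≥0`, the counting query on a range `S` is the sum of
the attributes of the elements of `S`. -/
noncomputable def count {X : Type*} [Finite X] (w : X → ℝ≥0) (S : Set X) : ℝ :=
  ∑ᶠ x ∈ S, (w x : ℝ)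

/-- Two attribute functions are neighboring if their `ℓ₁` distance is at most `1`. -/
def Neighboring {X : Type*} [Finite X] (w w' : X → ℝ≥0) : Prop :=
  ∑ᶠ x, |(w x : ℝ) - (w' x : ℝ)| ≤ 1

/-- A randomized mechanism for the (public) family of ranges `𝒮`: on every attribute function it
outputs a random vector of real answers, one for each range.  It is given by the law of that
vector. -/
abbrev Mechanism (X : Type*) (𝒮 : Set (Set X)) : Type _ :=
  (X → ℝ≥0) → ProbabilityMeasure (𝒮 → ℝ)

/-- `(ε, δ)`-differential privacy with respect to neighboring attribute functions. -/
def IsDP {X : Type*} [Finite X] {𝒮 : Set (Set X)} (M : Mechanism X 𝒮) (ε δ : ℝ) : Prop :=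
  ∀ w w' : X → ℝ≥0, Neighboring w w' → ∀ C : Set (𝒮 → ℝ), MeasurableSet C →
    (M w : Measure (𝒮 → ℝ)).real C ≤ Real.exp ε * (M w' : Measure (𝒮 → ℝ)).real C + δ

/-- `M` answers all counting queries with additive error at most `α`, except with probability at
most `β`: for every attribute function, with probability at least `1 - β`, the answers on all
ranges are simultaneously within `α` of the true values. -/
def HasError {X : Type*} [Finite X] {𝒮 : Set (Set X)} (M : Mechanism X 𝒮) (α β : ℝ) : Prop :=
  ∀ w : X → ℝ≥0,
    1 - β ≤ (M w : Measure (𝒮 → ℝ)).real {a | ∀ S : 𝒮, |count w (S : Set X) - a S| ≤ α}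

/-- The ranges given by all paths of a graph: the edge sets of the paths between any two
vertices. The ground set is the set of edges of the graph. -/
def pathRanges {V : Type*} (G : SimpleGraph V) : Set (Set G.edgeSet) :=
  {S | ∃ (u v : V) (p : G.Walk u v), p.IsPath ∧ S = {e | (e : Sym2 V) ∈ p.edges}}

end RangeQuery

/-! In the complete graph, paths cut out every subset of a matching of `k = n / 2` edges
(`exists_isPath_inter_matching`). Put weights from the grid `{0, 1/m, ..., (m-1)/m}` on it. Accurate
answers fix all subset sums up to `2α`, so a decoder recovers all but `4αm` weights. But resampling
one weight gives a neighboring input, so privacy lets the decoder guess a uniformly random weight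
with probability at most `exp ε / m + δ` (`agreement_bound`). For `m` large this falls below `1 -
β`, which forces `α` to be linear in `k`. -/

namespace RangeQuery

open Finset

/-! ### Privacy limits decoding -/

section Decoding

variable {ι κ : Type*} [Fintype ι] [DecidableEq ι] [Fintype κ]

/-- Exchanging the `i`-th coordinate of a function with a given value is an involution, so it
preserves sums over all pairs of a function and a value. -/
lemma sum_update_swap (i : ι) (h : (ι → κ) → κ → ℝ) :
    ∑ w : ι → κ, ∑ j : κ, h (Function.update w i j) (w i) = ∑ w : ι → κ, ∑ j : κ, h w j := by
  rw [← Fintype.sum_prod_type', ← Fintype.sum_prod_type' (f := h)]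
  have hinv : Function.Involutive
      (fun x : (ι → κ) × κ => (Function.update x.1 i x.2, x.1 i)) := by
    rintro ⟨w, j⟩
    simp
  exact Equiv.sum_comp hinv.toPerm (fun x : (ι → κ) × κ => h x.1 x.2)

/-- Let `p w` be a probability distribution on `ι → κ` for every `w : ι → κ`, such that changing a
single coordinate of `w` changes the law of every coordinate only in the sense of
`(ε, δ)`-indistinguishability.  Then `p w` cannot concentrate on functions that agree with `w` at
most places. -/
lemma agreement_bound [DecidableEq κ] [Nonempty κ] (p : (ι → κ) → (ι → κ) → ℝ) (hp : ∀ w f, 0 ≤ p w f)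
    (hp1 : ∀ w, ∑ f, p w f = 1) {A δ β r : ℝ} (hA : 0 ≤ A) (hδ : 0 ≤ δ) (hβ : β ≤ 1)
    (hDP : ∀ w i j j', ∑ f with f i = j', p w f ≤
      A * ∑ f with f i = j', p (Function.update w i j) f + δ)
    (hacc : ∀ w, 1 - β ≤ ∑ f with r ≤ (#{i | f i = w i} : ℝ), p w f) :
    (1 - β) * r ≤ Fintype.card ι * (A / Fintype.card κ + δ) := by
  have hm : (0 : ℝ) < Fintype.card κ := by exact_mod_cast Fintype.card_pos
  rcases le_or_gt r 0 with hr | hr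
  · exact (mul_nonpos_of_nonneg_of_nonpos (by linarith) hr).trans (by positivity)
  -- Markov's inequality for the expected number of agreements.
  have hlow : ∀ w, (1 - β) * r ≤ ∑ i, ∑ f with f i = w i, p w f := by
    intro w
    calc (1 - β) * r ≤ (∑ f with r ≤ (#{i | f i = w i} : ℝ), p w f) * r := by
          gcongr; exact hacc w
      _ = ∑ f with r ≤ (#{i | f i = w i} : ℝ), p w f * r := Finset.sum_mul _ _ _
      _ ≤ ∑ f with r ≤ (#{i | f i = w i} : ℝ), p w f * (#{i | f i = w i} : ℝ) := by
          refine Finset.sum_le_sum fun f hf => ?_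
          exact mul_le_mul_of_nonneg_left (Finset.mem_filter.1 hf).2 (hp w f)
      _ ≤ ∑ f, p w f * (#{i | f i = w i} : ℝ) :=
          Finset.sum_le_sum_of_subset_of_nonneg (Finset.filter_subset _ _)
            fun f _ _ => mul_nonneg (hp w f) (Nat.cast_nonneg _)
      _ = ∑ f, ∑ i, if f i = w i then p w f else 0 := by
          refine Finset.sum_congr rfl fun f _ => ?_
          rw [← Finset.sum_filter, Finset.sum_const, nsmul_eq_mul, mul_comm]
      _ = ∑ i, ∑ f with f i = w i, p w f := by
          rw [Finset.sum_comm]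
          simp only [Finset.sum_filter]
  -- Average over a resampled value `j`: after the swap, the guess is tested against a value
  -- independent of the input.
  have hup : ∀ i, ∑ w, ∑ f with f i = w i, p w f ≤
      Fintype.card (ι → κ) * (A / Fintype.card κ + δ) := by
    intro i
    have h1 : ∑ w : ι → κ, ∑ _j : κ, ∑ f with f i = w i, p w f ≤
        ∑ w : ι → κ, ∑ j : κ, (A * ∑ f with f i = w i, p (Function.update w i j) f + δ) :=
      Finset.sum_le_sum fun w _ => Finset.sum_le_sum fun j _ => hDP w i j (w i)
    have h2 : ∑ w : ι → κ, ∑ j : κ, ∑ f with f i = w i, p (Function.update w i j) f =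
        Fintype.card (ι → κ) := by
      rw [sum_update_swap i (fun w j => ∑ f with f i = j, p w f)]
      simp [Finset.sum_fiberwise, hp1]
    simp only [Finset.sum_const, nsmul_eq_mul, Finset.sum_add_distrib, ← Finset.mul_sum,
      Finset.card_univ] at h1
    rw [h2] at h1
    refine le_of_mul_le_mul_left (h1.trans_eq ?_) hm
    field_simp
  have hF : (0 : ℝ) < Fintype.card (ι → κ) := by exact_mod_cast Fintype.card_pos
  refine le_of_mul_le_mul_left ?_ hF
  calc (Fintype.card (ι → κ) : ℝ) * ((1 - β) * r)
      = ∑ _w : ι → κ, (1 - β) * r := by simp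
    _ ≤ ∑ w, ∑ i, ∑ f with f i = w i, p w f := Finset.sum_le_sum fun w _ => hlow w
    _ = ∑ i, ∑ w, ∑ f with f i = w i, p w f := Finset.sum_comm
    _ ≤ ∑ _i : ι, (Fintype.card (ι → κ) : ℝ) * (A / Fintype.card κ + δ) :=
        Finset.sum_le_sum fun i _ => hup i
    _ = _ := by simp; ring

end Decoding

/-! ### Weights on a family of elements -/

section Attributes

variable {X ι : Type*} [Fintype ι]

open Classical in
/-- The attribute function that places the weight `v i` on the element `e i`, for every `i`. -/
noncomputable def placed (e : ι → X) (v : ι → ℝ≥0) (x : X) : ℝ≥0 :=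
  ∑ i, if x = e i then v i else 0

lemma count_placed [Finite X] (e : ι → X) (v : ι → ℝ≥0) (S : Set X) (I : Finset ι)
    (hI : ∀ i, e i ∈ S ↔ i ∈ I) : count (placed e v) S = ∑ i ∈ I, (v i : ℝ) := by
  classical
  have := Fintype.ofFinite X
  have h : count (placed e v) S = ∑ x with x ∈ S, (placed e v x : ℝ) := by
    rw [count, ← finsum_mem_finset_eq_sum]
    simp
  simp only [h, placed, NNReal.coe_sum]
  rw [Finset.sum_comm, ← Finset.sum_filter_add_sum_filter_not univ (· ∈ I)]
  rw [Finset.sum_eq_zero (s := {i | i ∉ I}), add_zero]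
  · refine (Finset.sum_congr (by simp) fun i hi => ?_)
    rw [Finset.sum_eq_single (e i)]
    · simp
    · intro x _ hx
      simp [hx]
    · intro hx
      simp [hI, hi] at hx
  · intro i hi
    refine Finset.sum_eq_zero fun x hx => ?_
    have : x ≠ e i := by
      rintro rfl
      simp_all
    simp [this]

/-- Where values of `e` coincide, the weights add up, and the triangle inequality applies. -/
lemma neighboring_placed [Finite X] (e : ι → X) (v v' : ι → ℝ≥0)
    (h : ∑ i, |(v i : ℝ) - v' i| ≤ 1) : Neighboring (placed e v) (placed e v') := by
  classical
  have := Fintype.ofFinite X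
  rw [Neighboring, finsum_eq_sum_of_fintype]
  calc ∑ x, |(placed e v x : ℝ) - placed e v' x|
      ≤ ∑ x, ∑ i, if x = e i then |(v i : ℝ) - v' i| else 0 := by
        refine Finset.sum_le_sum fun x _ => ?_
        simp only [placed, NNReal.coe_sum, ← Finset.sum_sub_distrib]
        refine (Finset.abs_sum_le_sum_abs _ _).trans (Finset.sum_le_sum fun i _ => ?_)
        split_ifs <;> simp
    _ = ∑ i, |(v i : ℝ) - v' i| := by
        rw [Finset.sum_comm]
        simp
    _ ≤ 1 := h

/-- Two vectors whose sums over every set of coordinates are within `t` of each other have `ℓ₁`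
distance at most `2 * t`. -/
lemma sum_abs_sub_le_of_forall_sum (u v : ι → ℝ) (t : ℝ)
    (h : ∀ I : Finset ι, |∑ i ∈ I, u i - ∑ i ∈ I, v i| ≤ t) : ∑ i, |u i - v i| ≤ 2 * t := by
  classical
  -- The positive and negative parts of `u - v` each sum to at most `t`.
  have h1 := (abs_le.1 (h {i | v i ≤ u i})).2
  have h2 := (abs_le.1 (h {i | ¬ v i ≤ u i})).1
  rw [← Finset.sum_sub_distrib] at h1 h2
  rw [← Finset.sum_filter_add_sum_filter_not univ (fun i => v i ≤ u i)]
  have h3 : ∑ i with v i ≤ u i, |u i - v i| = ∑ i with v i ≤ u i, (u i - v i) :=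
    Finset.sum_congr rfl fun i hi => abs_of_nonneg (sub_nonneg.2 (by simpa using hi))
  have h4 : ∑ i with ¬ v i ≤ u i, |u i - v i| = -∑ i with ¬ v i ≤ u i, (u i - v i) := by
    rw [← Finset.sum_neg_distrib]
    refine Finset.sum_congr rfl fun i hi => abs_of_nonpos (sub_nonpos.2 ?_)
    have : u i < v i := by simpa using hi
    exact this.le
  linarith

end Attributes

/-! ### Shattered families force error -/

section Shattering

/-- The grid weights `f i / m`. -/
noncomputable def gridWeight {ι : Type*} {m : ℕ} (f : ι → Fin m) (i : ι) : ℝ≥0 := (f i : ℕ) / (m : ℝ≥0)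

lemma coe_gridWeight {ι : Type*} {m : ℕ} (f : ι → Fin m) (i : ι) :
    (gridWeight f i : ℝ) = (f i : ℕ) / (m : ℝ) := by
  simp [gridWeight]

variable {X ι : Type*} [Finite X] [Fintype ι] {𝒮 : Set (Set X)}

/-- The answers that are within `α` of the true ones for the attribute function `w`. -/
def accurateAnswers (𝒮 : Set (Set X)) (w : X → ℝ≥0) (α : ℝ) : Set (𝒮 → ℝ) :=
  {a | ∀ S : 𝒮, |count w (S : Set X) - a S| ≤ α}

lemma measurableSet_accurateAnswers (w : X → ℝ≥0) (α : ℝ) :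
    MeasurableSet (accurateAnswers 𝒮 w α) := by
  rw [accurateAnswers, Set.ofPred_forall]
  refine MeasurableSet.iInter fun S => ?_
  exact measurableSet_le (by fun_prop) measurable_const

/-- There is a measurable choice of an attribute function that is consistent with the answers,
whenever there is one. -/
lemma exists_measurable_selection {Ω F : Type*} [MeasurableSpace Ω] [Finite F] [Nonempty F]
    [MeasurableSpace F] (C : F → Set Ω) (hC : ∀ f, MeasurableSet (C f)) :
    ∃ g : Ω → F, Measurable g ∧ ∀ f, ∀ a ∈ C f, a ∈ C (g a) := by
  classical
  -- The choice depends only on which sets `C f` contain `a`, a point of a finite space.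
  let T : Ω → (F → Prop) := fun a f => a ∈ C f
  have hT : Measurable T := measurable_pi_iff.2 fun f => measurableSet_setOfPred.1 (hC f)
  let D : (F → Prop) → F := fun s => if h : ∃ f, s f then h.choose else Classical.arbitrary F
  refine ⟨D ∘ T, (measurable_of_countable D).comp hT, fun f a ha => ?_⟩
  have h : ∃ f, T a f := ⟨f, ha⟩
  have : D (T a) = h.choose := dif_pos h
  simpa [Function.comp, this] using h.choose_spec

/-- Differing grid weights differ by at least the mesh. -/
lemma card_agree_ge {m : ℕ} (hm : 0 < m) (f g : ι → Fin m) {t : ℝ}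
    (h : ∑ i, |(gridWeight f i : ℝ) - gridWeight g i| ≤ t) :
    (Fintype.card ι : ℝ) - t * m ≤ (#{i | g i = f i} : ℝ) := by
  have hm' : (0 : ℝ) < m := by exact_mod_cast hm
  have h1 : (#{i | ¬ g i = f i} : ℝ) ≤ t * m := by
    rw [← div_le_iff₀ hm']
    refine le_trans ?_ h
    calc (#{i | ¬ g i = f i} : ℝ) / m = ∑ i with ¬ g i = f i, (1 / m : ℝ) := by
          simp [div_eq_mul_inv]
      _ ≤ ∑ i with ¬ g i = f i, |(gridWeight f i : ℝ) - gridWeight g i| := by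
          refine Finset.sum_le_sum fun i hi => ?_
          rw [coe_gridWeight, coe_gridWeight, ← sub_div, abs_div, abs_of_pos hm']
          gcongr
          have hne : ((f i : ℕ) : ℤ) - (g i : ℕ) ≠ 0 := by
            have := (Finset.mem_filter.1 hi).2
            rw [Fin.ext_iff] at this
            omega
          exact_mod_cast Int.one_le_abs hne
      _ ≤ _ := Finset.sum_le_sum_of_subset_of_nonneg (Finset.filter_subset _ _)
          fun _ _ _ => abs_nonneg _
  have h2 : (#{i | g i = f i} : ℝ) + #{i | ¬ g i = f i} = Fintype.card ι := by
    exact_mod_cast Finset.card_filter_add_card_filter_not (s := univ) (fun i => g i = f i)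
  linarith

/-- All grid weights lie in `[0, 1)`. -/
lemma sum_abs_gridWeight_update_le [DecidableEq ι] {m : ℕ} (f : ι → Fin m) (i : ι) (j : Fin m) :
    ∑ i', |(gridWeight f i' : ℝ) - gridWeight (Function.update f i j) i'| ≤ 1 := by
  have hm' : (0 : ℝ) < m := by exact_mod_cast j.pos
  rw [Finset.sum_eq_single i]
  · rw [coe_gridWeight, coe_gridWeight, Function.update_self, ← sub_div, abs_div, abs_of_pos hm',
      div_le_one hm', abs_le]
    have h1 : ((f i : ℕ) : ℝ) ≤ m := by exact_mod_cast (f i).is_lt.le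
    have h2 : ((j : ℕ) : ℝ) ≤ m := by exact_mod_cast j.is_lt.le
    have h3 : (0 : ℝ) ≤ (f i : ℕ) := Nat.cast_nonneg _
    have h4 : (0 : ℝ) ≤ (j : ℕ) := Nat.cast_nonneg _
    constructor <;> linarith
  · intro i' _ hi'
    simp [coe_gridWeight, Function.update_of_ne hi']
  · simp

/-- If the ranges shatter the family `e`, then the additive error of a differentially private
mechanism is linear in the size of the family. -/
theorem error_bound_of_shatters (e : ι → X)
    (he : ∀ I : Finset ι, ∃ S ∈ 𝒮, ∀ i, e i ∈ S ↔ i ∈ I) (M : Mechanism X 𝒮)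
    {ε δ α β : ℝ} (hδ : 0 ≤ δ) (hβ : β ≤ 1) (hDP : IsDP M ε δ) (hM : HasError M α β)
    {m : ℕ} (hm : 0 < m) :
    (1 - β) * (Fintype.card ι - 4 * α * m) ≤ Fintype.card ι * (Real.exp ε / m + δ) := by
  classical
  have : NeZero m := ⟨hm.ne'⟩
  let w : (ι → Fin m) → X → ℝ≥0 := fun f => placed e (gridWeight f)
  obtain ⟨g, hg, hgC⟩ := exists_measurable_selection
    (fun f : ι → Fin m => accurateAnswers 𝒮 (w f) α)
    (fun f => measurableSet_accurateAnswers _ _)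
  have hagree : ∀ f, ∀ a ∈ accurateAnswers 𝒮 (w f) α,
      (Fintype.card ι - 4 * α * m : ℝ) ≤ (#{i | g a i = f i} : ℝ) := by
    intro f a ha
    -- True and decoded counts are both within `α` of the answer, hence within `2 * α` of each
    -- other.
    have h4 : 4 * α = 2 * (2 * α) := by ring
    rw [h4]
    refine card_agree_ge hm f (g a) (sum_abs_sub_le_of_forall_sum _ _ _ fun I => ?_)
    obtain ⟨S, hS, hSI⟩ := he I
    rw [← count_placed e _ S I hSI, ← count_placed e _ S I hSI]
    have h1 := abs_le.1 (ha ⟨S, hS⟩)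
    have h2 := abs_le.1 (hgC f a ha ⟨S, hS⟩)
    simp only [w] at h1 h2
    rw [abs_le]
    constructor <;> linarith [h1.1, h1.2, h2.1, h2.2]
  let p : (ι → Fin m) → (ι → Fin m) → ℝ := fun f f' =>
    (M (w f) : Measure (𝒮 → ℝ)).real (g ⁻¹' {f'})
  have hpsum : ∀ f (s : Finset (ι → Fin m)),
      ∑ f' ∈ s, p f f' = (M (w f) : Measure (𝒮 → ℝ)).real (g ⁻¹' s) := fun f s =>
    sum_measureReal_preimage_singleton s fun f' _ => hg (measurableSet_singleton f')
  have key := agreement_bound p (fun _ _ => measureReal_nonneg) (fun f => by simp [hpsum])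
    (Real.exp_pos ε).le hδ hβ (r := Fintype.card ι - 4 * α * m) (fun f i j j' => by
      rw [hpsum, hpsum]
      exact hDP _ _ (neighboring_placed e _ _ (sum_abs_gridWeight_update_le f i j)) _
        (hg (Finset.measurableSet _))) (fun f => by
      rw [hpsum]
      refine (hM (w f)).trans (measureReal_mono fun a ha => ?_)
      simpa using hagree f a ha)
  simpa using key

end Shattering

/-! ### Paths through a matching -/

section Paths

variable {V ι : Type*}

/-- In a complete graph, every nonempty set of edges of a matching is the intersection of the
matching with the edges of a path through the endpoints of these edges. -/
lemma exists_isPath_inter_matching (a b : ι → V) (ha : a.Injective) (hb : b.Injective)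
    (hab : ∀ i j, a i ≠ b j) {I : Finset ι} (hI : I.Nonempty) :
    ∃ (u v : V) (p : (⊤ : SimpleGraph V).Walk u v), p.IsPath ∧
      (∀ x ∈ p.support, ∃ i ∈ I, x = a i ∨ x = b i) ∧ ∀ i, s(a i, b i) ∈ p.edges ↔ i ∈ I := by
  induction hI using Finset.Nonempty.cons_induction with
  | singleton i =>
    have h : (⊤ : SimpleGraph V).Adj (a i) (b i) := hab i i
    refine ⟨a i, b i, .cons h .nil, by simp [hab], by simp, fun j => ?_⟩
    simp [ha.eq_iff, hb.eq_iff, hab]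
  | cons i I hi hI ih =>
    obtain ⟨u, v, p, hp, hsup, hedge⟩ := ih
    have ha' : a i ∉ p.support := fun h => by
      obtain ⟨j, hj, h | h⟩ := hsup _ h
      · exact hi (ha h ▸ hj)
      · exact hab _ _ h
    have hb' : b i ∉ p.support := fun h => by
      obtain ⟨j, hj, h | h⟩ := hsup _ h
      · exact hab _ _ h.symm
      · exact hi (hb h ▸ hj)
    have h1 : (⊤ : SimpleGraph V).Adj (a i) (b i) := hab i i
    have h2 : (⊤ : SimpleGraph V).Adj (b i) u := fun h => hb' (h ▸ p.start_mem_support)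
    refine ⟨a i, v, .cons h1 (.cons h2 p), ?_, ?_, fun j => ?_⟩
    · simp [SimpleGraph.Walk.cons_isPath_iff, hp, ha', hb', hab]
    · intro x hx
      simp only [SimpleGraph.Walk.support_cons, List.mem_cons] at hx
      rcases hx with rfl | rfl | hx
      · exact ⟨i, by simp⟩
      · exact ⟨i, by simp⟩
      · obtain ⟨j, hj, h⟩ := hsup x hx
        exact ⟨j, by simp [hj], h⟩
    · have h3 : s(a j, b j) ≠ s(b i, u) := by
        intro h
        rcases Sym2.eq_iff.1 h with ⟨h, -⟩ | ⟨h, h'⟩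
        · exact hab _ _ h
        · rw [hb h'] at h
          exact ha' (h ▸ p.start_mem_support)
      simp [h3, hedge, ha.eq_iff, hb.eq_iff, hab]

lemma pathRanges_top_shatters_matching [Nonempty V] (a b : ι → V) (ha : a.Injective)
    (hb : b.Injective) (hab : ∀ i j, a i ≠ b j) (I : Finset ι) :
    ∃ S ∈ pathRanges (⊤ : SimpleGraph V),
      ∀ i, (⟨s(a i, b i), hab i i⟩ : (⊤ : SimpleGraph V).edgeSet) ∈ S ↔ i ∈ I := by
  rcases I.eq_empty_or_nonempty with rfl | hI
  · let v : V := Classical.arbitrary V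
    exact ⟨∅, ⟨v, v, .nil, by simp, by simp⟩, by simp⟩
  · obtain ⟨u, v, p, hp, -, h⟩ := exists_isPath_inter_matching a b ha hb hab hI
    refine ⟨{e | (e : Sym2 V) ∈ p.edges}, ⟨u, v, p, hp, ?_⟩, h⟩
    ext e
    simpa using fun he => SimpleGraph.not_isDiag_of_mem_edgeSet _ (p.edges_subset_edgeSet he)

end Paths

end RangeQuery

open RangeQuery in
theorem mainTheorem4 (ε δ β : ℝ) (hε : 0 ≤ ε) (hδ : 0 ≤ δ) (hβ : 0 ≤ β) (hδβ : δ + β < 1) :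
    ∃ c : ℝ, 0 < c ∧ ∀ n : ℕ, 2 ≤ n →
      ∃ G : SimpleGraph (Fin n),
        ∀ (M : RangeQuery.Mechanism G.edgeSet (RangeQuery.pathRanges G)) (α : ℝ),
          RangeQuery.IsDP M ε δ → RangeQuery.HasError M α β → c * (n : ℝ) ≤ α := by
  set η : ℝ := 1 - β - δ with hη
  have hη0 : 0 < η := by linarith
  obtain ⟨m, hm⟩ := exists_nat_gt (2 * Real.exp ε / η)
  have hm0 : (0 : ℝ) < m := lt_of_le_of_lt (by positivity) hm
  have hm1 : Real.exp ε / m ≤ η / 2 := by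
    rw [div_lt_iff₀ hη0] at hm
    rw [div_le_iff₀ hm0]
    linarith
  -- `24 = 3 * 8`: below, `n ≤ 3 * k` and `k * η / 2 ≤ 4 * α * m`.
  refine ⟨η / (24 * m), by positivity, fun n hn => ⟨⊤, fun M α hDP hM => ?_⟩⟩
  have : Nonempty (Fin n) := ⟨⟨0, by omega⟩⟩
  let a : Fin (n / 2) → Fin n := fun i => ⟨2 * i, by omega⟩
  let b : Fin (n / 2) → Fin n := fun i => ⟨2 * i + 1, by omega⟩
  have key := error_bound_of_shatters _ (pathRanges_top_shatters_matching a b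
    (fun i j h => by simp only [a, Fin.ext_iff] at h ⊢; omega)
    (fun i j h => by simp only [b, Fin.ext_iff] at h ⊢; omega)
    (fun i j h => by simp only [a, b, Fin.ext_iff] at h; omega)) M hδ (by linarith) hDP hM
    (m := m) (by exact_mod_cast hm0)
  rw [Fintype.card_fin] at key
  set k : ℝ := ((n / 2 : ℕ) : ℝ) with hk
  have hkn : (n : ℝ) ≤ 3 * k := by
    have : n ≤ 3 * (n / 2) := by omega
    rw [hk]
    exact_mod_cast this
  have hk0 : 0 < k := by
    have : (2 : ℝ) ≤ n := by exact_mod_cast hn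
    linarith
  have h1 : k * (Real.exp ε / m + δ) ≤ k * (η / 2 + δ) := by gcongr
  have h2 : k * η / 2 ≤ (1 - β) * (4 * α * m) := by
    have : k * (η / 2 + δ) = k * (1 - β) - k * η / 2 := by rw [hη]; ring
    linarith
  -- Needed to drop the factor `1 - β ≤ 1` in `h4`.
  have hα : 0 ≤ α := by
    have h3 : 0 < ((1 - β) * 4 * m) * α := by
      have : 0 < k * η / 2 := by positivity
      linarith
    exact (pos_of_mul_pos_right h3 (by
      have : 0 ≤ 1 - β := by linarith
      positivity)).le
  have h4 : (1 - β) * (4 * α * m) ≤ 4 * α * m := by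
    have : 0 ≤ β * (4 * α * m) := by positivity
    linarith
  rw [div_mul_eq_mul_div, div_le_iff₀ (by positivity)]
  have h5 : η * n ≤ η * (3 * k) := by gcongr
  linarith
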